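/- Let $k,n\ge 0$ be integers and $m=kn+1$. An $(m,n)$-Dyck path $D$ is a path of $n$ North and $m$ East unit steps from $(0,0)$ to $(m,n)$ whose vertices all lie weakly above the main diagonal; its SW word is obtained by writing $S$ for each North step and $W$ for each East step. Let $\operatorname{area}(D)$ be the number of unit cells of the $m\times n$ rectangle that lie below $D$ and entirely above the main diagonal (that is, between $D$ and the cells cut by the main diagonal), and let $\operatorname{coarea}(D)=k\binom n2-\operatorname{area}(D)$. Let $T(D)$ be the tableau with $k+1$ rows and $n$ columns obtained from the SW word of $D$ by the Filling Algorithm: for $i=1,2,\dots,m+n-1$ in turn, if the $i$-th letter is $S$, place $i$ at the top of the first empty column; if it is $W$, place $i$ immediately below the smallest active entry, where an entry is active if it is currently at the bottom of its column and not in row $k+1$. For a tableau $T$ with $k+1$ rows and at least one column, let $\operatorname{red}(T)$ be obtained by removing the first column and replacing each remaining entry $a$ by $a-d_a$, where $d_a$ is the number of entries of the first column that are less than $a$. (1) If $T(D)$ has top row $(t_1,\dots,t_n)$ and bottom row $(b_1,\dots,b_n)$, then $\operatorname{coarea}(D)$ is the number of cells of the rectangle above $D$, and $$\operatorname{coarea}(D)=\sum_{i=1}^n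 t_i-\binom{n+1}{2},\qquad \operatorname{area}(D)=\sum_{i=1}^n b_i-(k+1)\binom{n+1}{2}.$$ (2) Suppose $n\ge 1$, and let $D$ be a $(kn+1,n)$-Dyck path and $D'$ a $(k(n-1)+1,n-1)$-Dyck path with $\operatorname{red}(T(D))=T(D')$. If the first entry of the bottom row of $T(D)$ is $b_1=k+j$, then $$\operatorname{area}(D)=\operatorname{area}(D')+j-1.$$ -/

import Mathlib

namespace FussDyck

/-- A unit step of a lattice path. As a letter of the SW word of a path, a North step is the
letter `S` (its starting point is a South end) and an East step is the letter `W`. -/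
inductive Step where
  | north : Step
  | east : Step
  deriving DecidableEq

/-- An `(m, n)`-Dyck path: a lattice path from `(0, 0)` to `(m, n)` made of `n` North and `m` East
unit steps, all of whose vertices `(x, y)` lie weakly above the diagonal from `(0, 0)` to `(m, n)`,
that is `n * x ≤ m * y`. The list of its steps is its SW word. -/
structure RationalDyckPath (m n : ℕ) where
  steps : List Step
  count_north : steps.count Step.north = n
  count_east : steps.count Step.east = m
  above_diagonal : ∀ i : ℕ,
    n * (steps.take i).count Step.east ≤ m * (steps.take i).count Step.north

variable {m n : ℕ}

/-- The unit cell `[x, x + 1] × [y, y + 1]`, given by `c = (x, y)`, lies above (to the left of) the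
path: the North step of the path that crosses row `y` has abscissa greater than `x`. -/
def RationalDyckPath.IsAbove (D : RationalDyckPath m n) (c : ℕ × ℕ) : Prop :=
  ∃ i ∈ Finset.range D.steps.length, D.steps[i]? = some Step.north ∧
    (D.steps.take i).count Step.north = c.2 ∧ c.1 < (D.steps.take i).count Step.east

instance (D : RationalDyckPath m n) : DecidablePred D.IsAbove := fun c => by
  unfold RationalDyckPath.IsAbove
  infer_instance

/-- The cells of the `m × n` rectangle that lie above the path. -/
def RationalDyckPath.cellsAbove (D : RationalDyckPath m n) : Finset (ℕ × ℕ) :=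
  (Finset.range m ×ˢ Finset.range n).filter fun c => D.IsAbove c

/-- The cells of the `m × n` rectangle between the path and the lattice diagonal (the set of cells
cut by the main diagonal): the cells that are not above the path and whose South-East corner
`(x + 1, y)` is weakly above the main diagonal. -/
def RationalDyckPath.areaCells (D : RationalDyckPath m n) : Finset (ℕ × ℕ) :=
  (Finset.range m ×ˢ Finset.range n).filter fun c => ¬ D.IsAbove c ∧ n * (c.1 + 1) ≤ m * c.2

/-- The area statistic. -/
def RationalDyckPath.area (D : RationalDyckPath m n) : ℕ := D.areaCells.card

/-- The coarea of a path in the Fuss case: the maximal area `k * C(n, 2)` minus the area. -/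
def coarea (k : ℕ) (D : RationalDyckPath (k * n + 1) n) : ℤ :=
  (k : ℤ) * (n.choose 2 : ℤ) - (D.area : ℤ)

/-- A partially filled tableau is the list of its nonempty columns from left to right, each column
being the list of its entries from top to bottom. The active entries are those at the bottom of a
column but not in row `k + 1`. -/
def activeEntries (k : ℕ) (cols : List (List ℕ)) : List ℕ :=
  (cols.filter fun c => c.length < k + 1).filterMap fun c => c.getLast?

/-- One stage of the Filling Algorithm. If the letter is `S`, place `i` at the top of the first
empty column; if it is `W`, place `i` immediately below the smallest active entry. (When there is
no active entry nothing is placed; this does not happen for the SW words of Dyck paths.) -/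
def place (k i : ℕ) (cols : List (List ℕ)) : Step → List (List ℕ)
  | Step.north => cols ++ [[i]]
  | Step.east =>
    match (activeEntries k cols).min? with
    | none => cols
    | some a => cols.map fun c => if c.getLast? = some a then c ++ [i] else c

/-- Run the Filling Algorithm on a word, the first letter of which is in position `i`. -/
def fill (k : ℕ) : ℕ → List (List ℕ) → List Step → List (List ℕ)
  | _, cols, [] => cols
  | i, cols, s :: w => fill k (i + 1) (place k i cols s) w

/-- The tableau `T(D)` with `k + 1` rows and `n` columns: the Filling Algorithm is run on the SW
word of `D` until `1, 2, …, m + n - 1` have been placed, where `m = k * n + 1`. (A position that is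
left empty would be given the value `0`.) -/
def tableau (k : ℕ) (D : RationalDyckPath (k * n + 1) n) : Matrix (Fin (k + 1)) (Fin n) ℕ :=
  let cols := fill k 1 [] (D.steps.take (k * n + 1 + n - 1))
  Matrix.of fun r c => ((cols[(c : ℕ)]?.getD [])[(r : ℕ)]?).getD 0

/-- The reduction `red(T)`: remove the first column and make the remaining entries contiguous, by
replacing each remaining entry `a` by `a - d`, where `d` is the number of entries of the first
column that are less than `a`. -/
def red {k : ℕ} (T : Matrix (Fin (k + 1)) (Fin (n + 1)) ℕ) : Matrix (Fin (k + 1)) (Fin n) ℕ :=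
  Matrix.of fun r c =>
    T r c.succ - (Finset.univ.filter fun s : Fin (k + 1) => T s 0 < T r c.succ).card

end FussDyck

open FussDyck

/-! The `y`-th North step (from `y = 0`) at abscissa `a` has position `a + y + 1`, so the top row
sums to the coarea plus `(n+1).choose 2`. In the Fuss case row `y` has exactly `k * y` cells left of
the lattice diagonal, so area and sum of abscissas add up to `k * n.choose 2`.

The bottom row is reached through the top row. The entries are `1, ..., (k+1)n`, so each is one more
than the number of smaller entries. Summing this over tops and bottoms gives a sum over ordered
pairs of columns, and `Interlaced` makes the contribution of each pair constant: a column `c` fills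
up before any `d` to its right, and (entries of `d` below `bot c`) + (entries of `c` below `top d`)
is `k + 1`. Hence `Filled.sum_top_add_sum_bot` fixes the total of the two rows, independently of the
path. The invariant is kept by each letter (`Filled.place_north`, `Filled.place_east`), and the Dyck
condition ensures that an active entry exists (`exists_active`).

For the reduction, every first-column entry is smaller than every later bottom entry, so each of
these drops by exactly `k + 1`; comparing the two bottom-row formulas gives the area recursion. -/

namespace FussDyck

/-! ### Columns and the pairwise invariant -/

/-- The top entry of a column. -/
def top (c : List ℕ) : ℕ := c.head?.getD 0

/-- The bottom entry of a column. -/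
def bot (c : List ℕ) : ℕ := c.getLast?.getD 0

lemma top_append {c : List ℕ} (hc : c ≠ []) (l : List ℕ) : top (c ++ l) = top c := by
  cases c <;> simp_all [top]

@[simp] lemma top_singleton (i : ℕ) : top [i] = i := rfl

@[simp] lemma bot_concat (c : List ℕ) (i : ℕ) : bot (c ++ [i]) = i := by simp [bot]

@[simp] lemma bot_singleton (i : ℕ) : bot [i] = i := rfl

lemma top_mem {c : List ℕ} (hc : c ≠ []) : top c ∈ c := by
  cases c <;> simp_all [top]

lemma getLast?_eq_bot {c : List ℕ} (hc : c ≠ []) : c.getLast? = some (bot c) := by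
  simp [bot, List.getLast?_eq_some_getLast hc]

lemma bot_mem {c : List ℕ} (hc : c ≠ []) : bot c ∈ c :=
  List.mem_of_getLast? (getLast?_eq_bot hc)

/-- A column of a tableau all of whose entries are at most `i`. -/
structure IsColumn (k i : ℕ) (c : List ℕ) : Prop where
  ne_nil : c ≠ []
  length_le : c.length ≤ k + 1
  sorted : c.Pairwise (· < ·)
  le : ∀ x ∈ c, x ≤ i

/-- The relation between a column `c` and a column `d` to its right in the Filling Algorithm:
since entries are placed below the smallest active entry, the two columns alternate from the moment
`d` is created until `c` is complete. -/
structure Interlaced (k : ℕ) (c d : List ℕ) : Prop where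
  top_lt : ∀ x ∈ d, top c < x
  bot_ne : bot c ≠ bot d
  complete : d.length = k + 1 → c.length = k + 1 ∧ ∀ x ∈ c, x < bot d
  active : c.length < k + 1 →
    (bot c < bot d ∧ c.length + 1 = d.length + c.countP (· < top d)) ∨
    (bot d < bot c ∧ c.length = d.length + c.countP (· < top d))
  crossing : c.length = k + 1 → d.countP (· < bot c) + c.countP (· < top d) = k + 1

lemma IsColumn.mono {k i j : ℕ} {c : List ℕ} (h : IsColumn k i c) (hij : i ≤ j) :
    IsColumn k j c :=
  ⟨h.ne_nil, h.length_le, h.sorted, fun x hx => (h.le x hx).trans hij⟩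

lemma IsColumn.concat {k i : ℕ} {c : List ℕ} (h : IsColumn k i c) (hc : c.length < k + 1) :
    IsColumn k (i + 1) (c ++ [i + 1]) where
  ne_nil := by simp
  length_le := by simpa using hc
  sorted := by
    rw [List.pairwise_append]
    refine ⟨h.sorted, by simp, fun a ha b hb => ?_⟩
    have := h.le a ha
    simp at hb
    omega
  le x hx := by
    rcases List.mem_append.1 hx with hx | hx
    · exact (h.le x hx).trans (by omega)
    · simp at hx; omega

lemma isColumn_singleton (k i : ℕ) : IsColumn k i [i] :=
  ⟨by simp, by simp, by simp, by simp⟩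

lemma IsColumn.bot_le {k i : ℕ} {c : List ℕ} (h : IsColumn k i c) : bot c ≤ i :=
  h.le _ (bot_mem h.ne_nil)

lemma IsColumn.top_le {k i : ℕ} {c : List ℕ} (h : IsColumn k i c) : top c ≤ i :=
  h.le _ (top_mem h.ne_nil)

lemma IsColumn.countP_lt {k i j : ℕ} {c : List ℕ} (h : IsColumn k i c) (hij : i < j) :
    c.countP (· < j) = c.length := by
  rw [List.countP_eq_length]
  intro x hx
  simpa using (h.le x hx).trans_lt hij

lemma IsColumn.interlaced_singleton {k i : ℕ} {c : List ℕ} (h : IsColumn k i c) :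
    Interlaced k c [i + 1] where
  top_lt x hx := by
    have := h.top_le
    simp at hx; omega
  bot_ne := by have := h.bot_le; simp; omega
  complete hk := by
    have h0 := List.length_pos_iff.2 h.ne_nil
    have := h.length_le
    refine ⟨by simp at hk; omega, fun x hx => ?_⟩
    have := h.le x hx
    simp; omega
  active _ := by
    left
    have := h.bot_le
    rw [top_singleton, h.countP_lt (Nat.lt_succ_self i)]
    simp; omega
  crossing hk := by
    have := h.bot_le
    have h1 : ¬ i + 1 < bot c := by omega
    rw [top_singleton, h.countP_lt (Nat.lt_succ_self i)]
    simp [h1, hk]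

lemma countP_lt_concat {c : List ℕ} {i x : ℕ} (h : x ≤ i) :
    (c ++ [i]).countP (· < x) = c.countP (· < x) := by
  simp [h]

/-- `hmin` expresses the choice of the smallest active entry: if `c` is incomplete, it received the
latest entry of the two, so now it is the turn of `d`. -/
lemma Interlaced.concat_right {k i : ℕ} {c d : List ℕ} (h : Interlaced k c d)
    (hc : IsColumn k i c) (hd : IsColumn k i d)
    (hmin : c.length < k + 1 → bot d ≤ bot c) : Interlaced k c (d ++ [i + 1]) where
  top_lt x hx := by
    rcases List.mem_append.1 hx with hx | hx
    · exact h.top_lt x hx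
    · have := hc.top_le
      simp at hx; omega
  bot_ne := by have := hc.bot_le; simp; omega
  complete hk := by
    have hlen : c.length = k + 1 := by
      by_contra hne
      have hlt : c.length < k + 1 := lt_of_le_of_ne hc.length_le hne
      have h1 := hmin hlt
      -- As `top c` precedes `top d`, the alternation gives `c.length ≥ d.length + 1 = k + 1`.
      have h2 : 0 < c.countP (· < top d) := List.countP_pos_iff.2
        ⟨top c, top_mem hc.ne_nil, by simpa using h.top_lt _ (top_mem hd.ne_nil)⟩
      simp at hk
      rcases h.active hlt with h3 | h3 <;> omega
    refine ⟨hlen, fun x hx => ?_⟩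
    have := hc.le x hx
    simp; omega
  active hck := by
    left
    have h1 := hmin hck
    have h2 := hc.bot_le
    rw [top_append hd.ne_nil]
    simp only [bot_concat, List.length_append, List.length_singleton]
    rcases h.active hck with h3 | h3 <;> omega
  crossing hck := by
    rw [top_append hd.ne_nil, countP_lt_concat (hc.bot_le.trans (by omega))]
    exact h.crossing hck

lemma Interlaced.concat_left {k i : ℕ} {c d : List ℕ} (h : Interlaced k c d)
    (hc : IsColumn k i c) (hd : IsColumn k i d) (hck : c.length < k + 1)
    (hmin : d.length < k + 1 → bot c ≤ bot d) : Interlaced k (c ++ [i + 1]) d := by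
  have hdk : d.length < k + 1 := lt_of_le_of_ne hd.length_le fun hk => by
    have := (h.complete hk).1
    omega
  have h1 := hmin hdk
  have h2 := hd.bot_le
  -- Minimality of `bot c` rules out the second alternative of `active`.
  have h3 : c.length + 1 = d.length + c.countP (· < top d) := by
    rcases h.active hck with h3 | h3 <;> omega
  have h4 : (c ++ [i + 1]).countP (· < top d) = c.countP (· < top d) :=
    countP_lt_concat (hd.top_le.trans (by omega))
  refine ⟨?_, ?_, ?_, ?_, ?_⟩
  · rw [top_append hc.ne_nil]; exact h.top_lt
  · simp; omega
  · omega
  · intro _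
    right
    rw [h4]
    simp only [bot_concat, List.length_append, List.length_singleton]
    omega
  · intro hk
    rw [h4, bot_concat, hd.countP_lt (Nat.lt_succ_self i)]
    simp at hk
    omega

/-! ### Preservation of the invariant by each letter -/

/-- The state of the Filling Algorithm after `1, …, i` have been placed. -/
structure Filled (k i : ℕ) (cols : List (List ℕ)) : Prop where
  isColumn : ∀ c ∈ cols, IsColumn k i c
  interlaced : cols.Pairwise (Interlaced k)
  perm : cols.flatten.Perm (List.range' 1 i)

lemma filled_nil (k : ℕ) : Filled k 0 [] := ⟨by simp, by simp, by simp⟩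

lemma Filled.length_flatten {k i : ℕ} {cols : List (List ℕ)} (h : Filled k i cols) :
    cols.flatten.length = i := by
  simpa using h.perm.length_eq

lemma Filled.place_north {k i : ℕ} {cols : List (List ℕ)} (h : Filled k i cols) :
    Filled k (i + 1) (place k (i + 1) cols Step.north) where
  isColumn c hc := by
    rcases List.mem_append.1 hc with hc | hc
    · exact (h.isColumn c hc).mono (by omega)
    · rw [List.mem_singleton.1 hc]; exact isColumn_singleton k _
  interlaced := by
    rw [place, List.pairwise_append]
    refine ⟨h.interlaced, by simp, fun c hc d hd => ?_⟩
    rw [List.mem_singleton.1 hd]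
    exact (h.isColumn c hc).interlaced_singleton
  perm := by
    rw [place, List.flatten_append, List.range'_1_concat, Nat.add_comm 1 i]
    exact h.perm.append (by simp)

lemma Filled.nodup_map_bot {k i : ℕ} {cols : List (List ℕ)} (h : Filled k i cols) :
    (cols.map bot).Nodup :=
  List.pairwise_map.2 (h.interlaced.imp fun h => h.bot_ne)

/-- Distinct bottoms ensure that the test in `place` selects one column only. -/
lemma flatten_map_concat {cols : List (List ℕ)} (hne : ∀ c ∈ cols, c ≠ [])
    (h : (cols.map bot).Nodup) {c : List ℕ} (hc : c ∈ cols) (i : ℕ) :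
    (cols.map fun d => if d.getLast? = some (bot c) then d ++ [i] else d).flatten.Perm
      (cols.flatten ++ [i]) := by
  obtain ⟨l₁, l₂, rfl⟩ := List.append_of_mem hc
  have key : ∀ d ∈ l₁ ++ l₂, (if d.getLast? = some (bot c) then d ++ [i] else d) = d := by
    intro d hd
    have hd' : d ∈ l₁ ++ c :: l₂ := by
      simp at hd ⊢; tauto
    rw [if_neg]
    rw [getLast?_eq_bot (hne d hd'), Option.some_inj]
    intro hb
    rw [List.map_append, List.map_cons, List.nodup_middle, List.nodup_cons, ← List.map_append]
      at h
    exact h.1 (hb ▸ List.mem_map_of_mem hd)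
  have k1 : (l₁.map fun d => if d.getLast? = some (bot c) then d ++ [i] else d) = l₁ :=
    (List.map_congr_left fun d hd => key d (by simp [hd])).trans (List.map_id' l₁)
  have k2 : (l₂.map fun d => if d.getLast? = some (bot c) then d ++ [i] else d) = l₂ :=
    (List.map_congr_left fun d hd => key d (by simp [hd])).trans (List.map_id' l₂)
  rw [List.map_append, List.map_cons, k1, k2, if_pos (getLast?_eq_bot (hne c hc))]
  simp only [List.flatten_append, List.flatten_cons, List.append_assoc]
  exact (List.Perm.refl _).append ((List.Perm.refl _).append List.perm_append_comm)

lemma mem_activeEntries {k : ℕ} {cols : List (List ℕ)} (hne : ∀ c ∈ cols, c ≠ []) {a : ℕ} :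
    a ∈ activeEntries k cols ↔ ∃ c ∈ cols, c.length < k + 1 ∧ bot c = a := by
  simp only [activeEntries, List.mem_filterMap, List.mem_filter, decide_eq_true_eq]
  constructor
  · rintro ⟨c, ⟨hc, hl⟩, hb⟩
    rw [getLast?_eq_bot (hne c hc), Option.some_inj] at hb
    exact ⟨c, hc, hl, hb⟩
  · rintro ⟨c, hc, hl, rfl⟩
    exact ⟨c, ⟨hc, hl⟩, getLast?_eq_bot (hne c hc)⟩

lemma Filled.place_east {k i : ℕ} {cols : List (List ℕ)} (h : Filled k i cols)
    (hact : ∃ c ∈ cols, c.length < k + 1) :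
    Filled k (i + 1) (place k (i + 1) cols Step.east) := by
  have hne : ∀ c ∈ cols, c ≠ [] := fun c hc => (h.isColumn c hc).ne_nil
  cases hm : (activeEntries k cols).min? with
  | none =>
    obtain ⟨c, hc, hl⟩ := hact
    rw [List.min?_eq_none_iff] at hm
    have := (mem_activeEntries hne).2 ⟨c, hc, hl, rfl⟩
    simp [hm] at this
  | some a =>
    obtain ⟨ha, hmin⟩ := List.min?_eq_some_iff.1 hm
    obtain ⟨c, hc, hck, rfl⟩ := (mem_activeEntries hne).1 ha
    have hmin' : ∀ d ∈ cols, d.length < k + 1 → bot c ≤ bot d := fun d hd hl =>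
      hmin _ ((mem_activeEntries hne).2 ⟨d, hd, hl, rfl⟩)
    have huniq : ∀ d ∈ cols, d.getLast? = some (bot c) → d = c := fun d hd hb => by
      rw [getLast?_eq_bot (hne d hd), Option.some_inj] at hb
      exact List.inj_on_of_nodup_map h.nodup_map_bot hd hc hb
    have hp : place k (i + 1) cols Step.east =
        cols.map fun d => if d.getLast? = some (bot c) then d ++ [i + 1] else d := by
      simp [place, hm]
    rw [hp]
    refine ⟨?_, ?_, ?_⟩
    · intro e he
      obtain ⟨d, hd, rfl⟩ := List.mem_map.1 he
      split_ifs with hb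
      · obtain rfl := huniq d hd hb
        exact (h.isColumn d hd).concat hck
      · exact (h.isColumn d hd).mono (by omega)
    · rw [List.pairwise_map]
      refine h.interlaced.imp_of_mem fun {d e} hd he hde => ?_
      split_ifs with hb hb' hb'
      · obtain rfl := huniq d hd hb
        obtain rfl := huniq e he hb'
        exact absurd rfl hde.bot_ne
      · obtain rfl := huniq d hd hb
        exact hde.concat_left (h.isColumn _ hd) (h.isColumn _ he) hck (hmin' e he)
      · obtain rfl := huniq e he hb'
        exact hde.concat_right (h.isColumn _ hd) (h.isColumn _ he) (hmin' d hd)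
      · exact hde
    · rw [List.range'_1_concat, Nat.add_comm 1 i]
      exact (flatten_map_concat hne h.nodup_map_bot hc _).trans (h.perm.append_right _)

/-! ### Numbers of columns and of entries -/

lemma place_length (k i : ℕ) (cols : List (List ℕ)) (s : Step) :
    (place k i cols s).length = cols.length + [s].count Step.north := by
  cases s
  · simp [place]
  · simp only [place]
    split <;> simp

lemma fill_append (k i : ℕ) (cols : List (List ℕ)) (u v : List Step) :
    fill k i cols (u ++ v) = fill k (i + u.length) (fill k i cols u) v := by
  induction u generalizing i cols with
  | nil => rfl
  | cons s u ih =>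
    simp only [List.cons_append, fill, ih, List.length_cons]
    congr 1
    omega

lemma fill_length (k i : ℕ) (cols : List (List ℕ)) (w : List Step) :
    (fill k i cols w).length = cols.length + w.count Step.north := by
  induction w generalizing i cols with
  | nil => rfl
  | cons s w ih =>
    rw [fill, ih, place_length, Nat.add_assoc, ← List.count_append, List.singleton_append]

lemma length_flatten_le {K : ℕ} {L : List (List ℕ)} (h : ∀ c ∈ L, c.length ≤ K) :
    L.flatten.length ≤ L.length * K := by
  induction L with
  | nil => simp
  | cons c L ih =>
    have h1 := h c (by simp)
    have h2 := ih fun d hd => h d (by simp [hd])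
    simp only [List.flatten_cons, List.length_append, List.length_cons, Nat.succ_mul]
    omega

lemma length_eq_of_length_flatten {K : ℕ} {L : List (List ℕ)} (h : ∀ c ∈ L, c.length ≤ K)
    (hL : L.flatten.length = L.length * K) : ∀ c ∈ L, c.length = K := by
  induction L with
  | nil => simp
  | cons c L ih =>
    have h1 := h c (by simp)
    have h3 : ∀ d ∈ L, d.length ≤ K := fun d hd => h d (by simp [hd])
    have h2 := length_flatten_le h3
    simp only [List.flatten_cons, List.length_append, List.length_cons, Nat.succ_mul] at hL
    intro d hd
    rcases List.mem_cons.1 hd with rfl | hd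
    · omega
    · exact ih h3 (by omega) d hd

lemma le_length_flatten {K : ℕ} {L : List (List ℕ)} (h : ∀ c ∈ L, K ≤ c.length) :
    L.length * K ≤ L.flatten.length := by
  induction L with
  | nil => simp
  | cons c L ih =>
    have h1 := h c (by simp)
    have h2 := ih fun d hd => h d (by simp [hd])
    simp only [List.flatten_cons, List.length_append, List.length_cons, Nat.succ_mul]
    omega

/-! ### Sum of the top and bottom rows by counting smaller entries -/

variable {m n : ℕ}

lemma countP_lt_range' {N x : ℕ} (hx : 1 ≤ x) (hxN : x ≤ N + 1) :
    (List.range' 1 N).countP (· < x) + 1 = x := by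
  induction N with
  | zero => simp; omega
  | succ N ih =>
    rw [List.range'_1_concat, List.countP_append]
    rcases Nat.lt_or_ge (N + 1) x with h | h
    · obtain rfl : x = N + 2 := by omega
      have : (List.range' 1 N).countP (· < N + 2) = (List.range' 1 N).length := by
        rw [List.countP_eq_length]
        intro a ha
        rw [List.mem_range'_1] at ha
        simp; omega
      rw [this]
      simp; omega
    · have h1 : ¬ 1 + N < x := by omega
      simpa [h1] using ih h

/-- Splits a sum over ordered pairs into the diagonal and the unordered pairs. -/
lemma sum_map_sum_map_of_pairwise {α : Type*} (G : α → α → ℕ) {K M : ℕ} {L : List α}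
    (hd : ∀ a ∈ L, G a a = M) (hL : L.Pairwise fun a b => G a b + G b a = K) :
    (L.map fun a => (L.map (G a)).sum).sum = L.length * M + L.length.choose 2 * K := by
  induction L with
  | nil => simp
  | cons a L ih =>
    rw [List.pairwise_cons] at hL
    have h1 := ih (fun b hb => hd b (by simp [hb])) hL.2
    have h2 : (L.map (G a)).sum + (L.map fun b => G b a).sum = L.length * K := by
      rw [← List.sum_map_add, List.map_congr_left hL.1]
      simp
    have h3 := hd a (by simp)
    simp only [List.map_cons, List.sum_cons, List.sum_map_add, List.length_cons, h1, h3]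
    rw [Nat.choose_succ_succ' L.length 1, Nat.choose_one_right]
    linear_combination h2

lemma Filled.countP_lt_flatten {k i : ℕ} {cols : List (List ℕ)} (h : Filled k i cols) {x : ℕ}
    (hx : x ∈ cols.flatten) : cols.flatten.countP (· < x) + 1 = x := by
  rw [h.perm.countP_eq]
  have := h.perm.mem_iff.1 hx
  rw [List.mem_range'_1] at this
  exact countP_lt_range' (by omega) (by omega)

lemma IsColumn.countP_lt_top {k i : ℕ} {c : List ℕ} (h : IsColumn k i c) :
    c.countP (· < top c) = 0 := by
  obtain ⟨a, l, rfl⟩ := List.exists_cons_of_ne_nil h.ne_nil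
  rw [List.countP_eq_zero]
  have := List.pairwise_cons.1 h.sorted
  intro x hx
  rcases List.mem_cons.1 hx with rfl | hx
  · simp [top]
  · exact fun h => (this.1 x hx).not_gt (of_decide_eq_true h)

lemma IsColumn.countP_lt_bot {k i : ℕ} {c : List ℕ} (h : IsColumn k i c) :
    c.countP (· < bot c) + 1 = c.length := by
  rcases List.eq_nil_or_concat' c with hc | ⟨l, a, rfl⟩
  · exact absurd hc h.ne_nil
  · have h1 := (List.pairwise_append.1 h.sorted).2.2
    have : l.countP (· < a) = l.length := by
      rw [List.countP_eq_length]
      intro x hx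
      simpa using h1 x hx a (by simp)
    simp [this]

lemma Filled.sum_top_add_sum_bot {k i : ℕ} {cols : List (List ℕ)} (h : Filled k i cols)
    (hlen : ∀ c ∈ cols, c.length = k + 1) :
    (cols.map top).sum + (cols.map bot).sum =
      cols.length * (k + 2) + cols.length.choose 2 * (2 * (k + 1)) := by
  -- A column has no entry below its top and `k` below its bottom, whence `M`. For `c` left of `d`
  -- the four counts are `0`, `k + 1` (all of `c` below `bot d`), and two that add up to `k + 1` by
  -- `crossing`, whence `K`.
  have key := sum_map_sum_map_of_pairwise
    (fun c d : List ℕ => d.countP (· < top c) + d.countP (· < bot c)) (K := 2 * (k + 1))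
    (M := k) (L := cols) ?_ ?_
  · have h1 : ∀ c ∈ cols,
        (cols.map fun d => d.countP (· < top c) + d.countP (· < bot c)).sum + 2 =
          top c + bot c := by
      intro c hc
      have h2 := h.countP_lt_flatten
        (List.mem_flatten.2 ⟨c, hc, top_mem (h.isColumn c hc).ne_nil⟩)
      have h3 := h.countP_lt_flatten
        (List.mem_flatten.2 ⟨c, hc, bot_mem (h.isColumn c hc).ne_nil⟩)
      rw [List.countP_flatten] at h2 h3
      rw [List.sum_map_add]
      omega
    rw [← List.sum_map_add, ← List.map_congr_left h1, List.sum_map_add, key]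
    simp
    ring
  · intro c hc
    have h1 := (h.isColumn c hc).countP_lt_top
    have h2 := (h.isColumn c hc).countP_lt_bot
    have h3 := hlen c hc
    omega
  · refine h.interlaced.imp_of_mem fun {c d} hc hd hcd => ?_
    have h1 : d.countP (· < top c) = 0 := by
      rw [List.countP_eq_zero]
      intro x hx
      have := hcd.top_lt x hx
      simp; omega
    have h2 := hcd.crossing (hlen c hc)
    have h3 : c.countP (· < bot d) = c.length := by
      rw [List.countP_eq_length]
      intro x hx
      simpa using (hcd.complete (hlen d hd)).2 x hx
    have h4 := hlen c hc
    omega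

/-! ### Abscissas of North steps and the top row -/

/-- The abscissas of the North steps of a path starting on the vertical axis. -/
def abscissas : List Step → List ℕ
  | [] => []
  | Step.north :: w => 0 :: abscissas w
  | Step.east :: w => (abscissas w).map (· + 1)

lemma length_abscissas (w : List Step) : (abscissas w).length = w.count Step.north := by
  induction w with
  | nil => rfl
  | cons s w ih => cases s <;> simp [abscissas, ih]

lemma abscissas_concat_east (w : List Step) : abscissas (w ++ [Step.east]) = abscissas w := by
  induction w with
  | nil => rfl
  | cons s w ih => cases s <;> simp [abscissas, ih]

lemma getElem?_abscissas {w : List Step} {y a : ℕ} : (abscissas w)[y]? = some a ↔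
    ∃ i, w[i]? = some Step.north ∧ (w.take i).count Step.north = y ∧
      (w.take i).count Step.east = a := by
  induction w generalizing y a with
  | nil => simp [abscissas]
  | cons s w ih =>
    rw [← Nat.or_exists_add_one]
    cases s
    · cases y with
      | zero => simp [abscissas, eq_comm]
      | succ y => simp [abscissas, ih]
    · cases a with
      | zero => simp [abscissas]
      | succ a => simp [abscissas, ih]

lemma top_map_place_east (k i : ℕ) {cols : List (List ℕ)} (h : ∀ c ∈ cols, c ≠ []) :
    (place k i cols Step.east).map top = cols.map top := by
  simp only [place]
  split
  · rfl
  · rw [List.map_map]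
    refine List.map_congr_left fun c hc => ?_
    simp only [Function.comp_apply]
    split_ifs
    · exact top_append (h c hc) _
    · rfl

lemma place_ne_nil (k i : ℕ) {cols : List (List ℕ)} (h : ∀ c ∈ cols, c ≠ []) (s : Step) :
    ∀ c ∈ place k i cols s, c ≠ [] := by
  cases s
  · intro c hc
    rcases List.mem_append.1 hc with hc | hc
    · exact h c hc
    · simp_all
  · simp only [place]
    split
    · exact h
    · intro c hc
      obtain ⟨d, hd, rfl⟩ := List.mem_map.1 hc
      split_ifs
      · simp
      · exact h d hd

/-- Only North steps create tops, and the `y`-th one of `w`, at abscissa `a`, is in position `i + y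
+ a`. -/
lemma sum_top_fill (k i : ℕ) {cols : List (List ℕ)} (h : ∀ c ∈ cols, c ≠ []) (w : List Step) :
    ((fill k i cols w).map top).sum = (cols.map top).sum + (abscissas w).sum +
      w.count Step.north * i + (w.count Step.north).choose 2 := by
  induction w generalizing i cols with
  | nil => simp [fill, abscissas]
  | cons s w ih =>
    rw [fill, ih (i + 1) (place_ne_nil k i h s)]
    cases s
    · simp only [place, List.map_append, List.sum_append, abscissas, List.sum_cons,
        List.count_cons_self, Nat.choose_succ_succ' _ 1, Nat.choose_one_right]
      simp
      ring
    · rw [top_map_place_east k i h]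
      simp [abscissas, List.sum_map_add, length_abscissas]
      ring

lemma sum_range_getElem?_getD {α : Type*} (f : α → ℕ) (a : α) (L : List α) :
    ∑ y ∈ Finset.range L.length, f (L[y]?.getD a) = (L.map f).sum := by
  induction L with
  | nil => simp
  | cons b L ih =>
    rw [List.length_cons, Finset.sum_range_succ', List.map_cons, List.sum_cons, ← ih, add_comm]
    simp

lemma length_eq_count_add_count (w : List Step) :
    w.length = w.count Step.north + w.count Step.east := by
  induction w with
  | nil => rfl
  | cons s w ih => cases s <;> simp [ih] <;> omega

/-! ### Area and coarea by rows -/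

namespace RationalDyckPath

/-- The abscissa of the North step of the path that crosses row `y`. -/
def abscissa (D : RationalDyckPath m n) (y : ℕ) : ℕ := (abscissas D.steps)[y]?.getD 0

variable (D : RationalDyckPath m n)

lemma isAbove_iff (c : ℕ × ℕ) : D.IsAbove c ↔ c.1 < D.abscissa c.2 := by
  unfold IsAbove abscissa
  constructor
  · rintro ⟨i, -, h1, h2, h3⟩
    rw [getElem?_abscissas.2 ⟨i, h1, h2, rfl⟩]
    exact h3
  · intro h
    cases ha : (abscissas D.steps)[c.2]? with
    | none => simp [ha] at h
    | some a =>
      obtain ⟨i, h1, h2, rfl⟩ := getElem?_abscissas.1 ha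
      rw [ha] at h
      exact ⟨i, Finset.mem_range.2 (List.getElem?_eq_some_iff.1 h1).1, h1, h2, h⟩

lemma length_steps : D.steps.length = m + n := by
  rw [length_eq_count_add_count, D.count_east, D.count_north, Nat.add_comm]

lemma exists_abscissa {y : ℕ} (hy : y < n) : ∃ i, (D.steps.take i).count Step.north = y ∧
    (D.steps.take i).count Step.east = D.abscissa y := by
  have h : y < (abscissas D.steps).length := by rwa [length_abscissas, D.count_north]
  obtain ⟨i, -, h2, h3⟩ := getElem?_abscissas.1 (List.getElem?_eq_getElem h)
  exact ⟨i, h2, by simp [h3, abscissa, h]⟩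

lemma sum_abscissa : ∑ y ∈ Finset.range n, D.abscissa y = (abscissas D.steps).sum := by
  have := sum_range_getElem?_getD id 0 (abscissas D.steps)
  rw [length_abscissas, D.count_north] at this
  simpa [abscissa] using this

lemma abscissa_le {y : ℕ} (hy : y < n) : D.abscissa y ≤ m := by
  obtain ⟨i, -, h⟩ := D.exists_abscissa hy
  rw [← h]
  refine le_of_le_of_eq ?_ D.count_east
  exact (List.take_sublist _ _).count_le _

lemma card_cellsAbove : D.cellsAbove.card = (abscissas D.steps).sum := by
  rw [← sum_abscissa, cellsAbove, Finset.card_filter, Finset.sum_product_right]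
  refine Finset.sum_congr rfl fun y hy => ?_
  rw [← Finset.card_filter]
  have : (Finset.range m).filter (fun x => D.IsAbove (x, y)) = Finset.range (D.abscissa y) := by
    ext x
    have := D.abscissa_le (Finset.mem_range.1 hy)
    simp only [Finset.mem_filter, Finset.mem_range, isAbove_iff]
    omega
  rw [this, Finset.card_range]

/-- The surplus `y` over `n * (k * y)` is less than `n`, so it cannot pay for another unit of `x`.
This is where `m = kn + 1` behaves like slope `1 / k`. -/
lemma le_mul_of_mul_le {k x y : ℕ} (hy : y < n) (h : n * x ≤ (k * n + 1) * y) : x ≤ k * y := by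
  by_contra hx
  have := Nat.mul_le_mul_left n (Nat.succ_le_of_lt (not_le.1 hx))
  nlinarith

lemma fuss_abscissa_le {k : ℕ} (D : RationalDyckPath (k * n + 1) n) {y : ℕ} (hy : y < n) :
    D.abscissa y ≤ k * y := by
  obtain ⟨i, h1, h2⟩ := D.exists_abscissa hy
  have := D.above_diagonal i
  rw [h1, h2] at this
  exact le_mul_of_mul_le hy this

lemma area_add_sum_abscissas {k : ℕ} (D : RationalDyckPath (k * n + 1) n) :
    D.area + (abscissas D.steps).sum = k * n.choose 2 := by
  rw [← sum_abscissa, area, areaCells, Finset.card_filter, Finset.sum_product_right,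
    ← Finset.sum_add_distrib, Nat.choose_two_right, ← Finset.sum_range_id, Finset.mul_sum]
  refine Finset.sum_congr rfl fun y hy => ?_
  have hy' := Finset.mem_range.1 hy
  rw [← Finset.card_filter]
  have h1 := D.fuss_abscissa_le hy'
  have h2 : (Finset.range (k * n + 1)).filter
      (fun x => ¬ D.IsAbove (x, y) ∧ n * (x + 1) ≤ (k * n + 1) * y) =
      Finset.Ico (D.abscissa y) (k * y) := by
    ext x
    simp only [Finset.mem_filter, Finset.mem_range, isAbove_iff, Finset.mem_Ico, not_lt]
    constructor
    · rintro ⟨-, h3, h4⟩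
      exact ⟨h3, le_mul_of_mul_le hy' h4⟩
    · rintro ⟨h3, h4⟩
      have h5 : k * y ≤ k * n := Nat.mul_le_mul_left k hy'.le
      refine ⟨by omega, h3, ?_⟩
      have := Nat.mul_le_mul_left n (Nat.succ_le_of_lt h4)
      nlinarith
  rw [h2, Nat.card_Ico]
  omega

end RationalDyckPath

/-! ### The tableau of a Fuss path -/

namespace RationalDyckPath

variable {k n : ℕ} (D : RationalDyckPath (k * n + 1) n)

/-- The list of the columns of the tableau of a Dyck path. -/
def columns : List (List ℕ) := fill k 1 [] (D.steps.take (k * n + 1 + n - 1))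

/-- The discarded last letter is East: otherwise the path would reach abscissa `m` below height `n`,
under the diagonal. -/
lemma count_north_take_fuss : (D.steps.take (k * n + 1 + n - 1)).count Step.north = n := by
  rcases Nat.eq_zero_or_pos n with rfl | hn
  · simp
  have h1 := D.above_diagonal (k * n + 1 + n - 1)
  have h2 := length_eq_count_add_count (D.steps.take (k * n + 1 + n - 1))
  have h3 : (D.steps.take (k * n + 1 + n - 1)).count Step.north ≤ n :=
    le_of_le_of_eq ((List.take_sublist _ _).count_le _) D.count_north
  rw [List.length_take, D.length_steps, min_eq_left (by omega)] at h2
  generalize (D.steps.take (k * n + 1 + n - 1)).count Step.north = S at *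
  generalize (D.steps.take (k * n + 1 + n - 1)).count Step.east = E at *
  by_contra hne
  have h4 : S + 1 ≤ n := by omega
  have h5 : k * n + 1 ≤ E := by omega
  nlinarith

lemma abscissas_take_fuss :
    abscissas (D.steps.take (k * n + 1 + n - 1)) = abscissas D.steps := by
  have hlt : k * n + 1 + n - 1 < D.steps.length := by rw [D.length_steps]; omega
  have h1 : D.steps.take (k * n + 1 + n - 1) ++ [D.steps[k * n + 1 + n - 1]] = D.steps := by
    rw [List.take_append_getElem, List.take_of_length_le (by rw [D.length_steps]; omega)]
  have h2 := congrArg (List.count Step.north) h1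
  rw [List.count_append, D.count_north, D.count_north_take_fuss] at h2
  cases hs : D.steps[k * n + 1 + n - 1] with
  | north =>
    rw [hs] at h2
    simp at h2
  | east =>
    rw [hs] at h1
    rw [← abscissas_concat_east, h1]

/-- If all columns were full, the path would be at or beyond abscissa `k * S` at height `S`; a
further East step stays above the diagonal only if `S ≥ n`, and then all `kn + n` positions are
already used. -/
lemma exists_active {j : ℕ} (hj : j < k * n + n) {cols : List (List ℕ)}
    (hcols : cols.length = (D.steps.take j).count Step.north) (h : cols.flatten.length = j)
    (hs : (D.steps.take (j + 1)).count Step.east = (D.steps.take j).count Step.east + 1)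
    (hs' : (D.steps.take (j + 1)).count Step.north = (D.steps.take j).count Step.north) :
    ∃ c ∈ cols, c.length < k + 1 := by
  by_contra! hc
  have h1 := le_length_flatten hc
  have h2 := D.above_diagonal (j + 1)
  have h3 := length_eq_count_add_count (D.steps.take j)
  rw [List.length_take, D.length_steps, min_eq_left (by omega)] at h3
  rw [hs, hs'] at h2
  rw [h, hcols] at h1
  generalize (D.steps.take j).count Step.north = S at *
  generalize (D.steps.take j).count Step.east = E at *
  have h4 : k * S ≤ E := by nlinarith
  have h5 : n ≤ S := by nlinarith
  nlinarith

lemma filled_take {j : ℕ} (hj : j ≤ k * n + n) : Filled k j (fill k 1 [] (D.steps.take j)) := by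
  induction j with
  | zero => exact filled_nil k
  | succ j ih =>
    have h := ih (by omega)
    have hlt : j < D.steps.length := by rw [D.length_steps]; omega
    have h1 : D.steps.take (j + 1) = D.steps.take j ++ [D.steps[j]] :=
      (List.take_append_getElem hlt).symm
    have h2 : fill k 1 [] (D.steps.take (j + 1)) =
        place k (j + 1) (fill k 1 [] (D.steps.take j)) D.steps[j] := by
      rw [h1, fill_append, List.length_take, min_eq_left hlt.le, Nat.add_comm 1 j]
      rfl
    rw [h2]
    cases hs : D.steps[j] with
    | north => exact h.place_north
    | east =>
      rw [hs] at h1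
      refine h.place_east (D.exists_active (by omega) ?_ h.length_flatten ?_ ?_)
      · simp [fill_length]
      · simp [h1]
      · simp [h1]

lemma filled_columns : Filled k (k * n + n) D.columns := by
  have h := D.filled_take le_rfl
  rwa [show k * n + n = k * n + 1 + n - 1 by omega] at h ⊢

lemma length_columns : D.columns.length = n := by
  rw [columns, fill_length, D.count_north_take_fuss]
  simp

/-- The `n` columns have capacity `k + 1` each and hold `(k + 1) * n` entries together. -/
lemma length_of_mem_columns : ∀ c ∈ D.columns, c.length = k + 1 := by
  refine length_eq_of_length_flatten (fun c hc => (D.filled_columns.isColumn c hc).length_le) ?_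
  rw [D.filled_columns.length_flatten, D.length_columns]
  ring

lemma sum_top_columns :
    (D.columns.map top).sum = (abscissas D.steps).sum + (n + 1).choose 2 := by
  rw [columns, sum_top_fill k 1 (by simp), D.abscissas_take_fuss, D.count_north_take_fuss,
    Nat.choose_succ_succ' n 1, Nat.choose_one_right]
  simp
  ring

lemma area_add_eq_sum_bot_columns :
    D.area + (k + 1) * (n + 1).choose 2 = (D.columns.map bot).sum := by
  have h1 := D.filled_columns.sum_top_add_sum_bot D.length_of_mem_columns
  have h2 := D.sum_top_columns
  have h3 := D.area_add_sum_abscissas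
  rw [D.length_columns] at h1
  rw [Nat.choose_succ_succ' n 1, Nat.choose_one_right] at h2 ⊢
  linarith

lemma tableau_apply (r : Fin (k + 1)) (c : Fin n) :
    tableau k D r c = ((D.columns[(c : ℕ)]?.getD [])[(r : ℕ)]?).getD 0 := rfl

lemma tableau_zero (c : Fin n) : tableau k D 0 c = top (D.columns[(c : ℕ)]?.getD []) := by
  rw [tableau_apply, top, List.head?_eq_getElem?]
  rfl

lemma getElem?_columns_getD_mem (c : Fin n) : D.columns[(c : ℕ)]?.getD [] ∈ D.columns := by
  rw [List.getElem?_eq_getElem (by rw [D.length_columns]; exact c.2)]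
  exact List.getElem_mem _

lemma tableau_last (c : Fin n) :
    tableau k D (Fin.last k) c = bot (D.columns[(c : ℕ)]?.getD []) := by
  rw [tableau_apply, bot, List.getLast?_eq_getElem?,
    D.length_of_mem_columns _ (D.getElem?_columns_getD_mem c)]
  rfl

lemma tableau_mem (r : Fin (k + 1)) (c : Fin n) :
    tableau k D r c ∈ D.columns[(c : ℕ)]?.getD [] := by
  have h := D.length_of_mem_columns _ (D.getElem?_columns_getD_mem c)
  have hr : (r : ℕ) < (D.columns[(c : ℕ)]?.getD []).length := by rw [h]; exact r.2
  rw [tableau_apply, List.getElem?_eq_getElem hr]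
  exact List.getElem_mem _

lemma sum_columns (f : List ℕ → ℕ) :
    ∑ c : Fin n, f (D.columns[(c : ℕ)]?.getD []) = (D.columns.map f).sum := by
  rw [← sum_range_getElem?_getD f [] D.columns, D.length_columns, Finset.sum_range]

lemma sum_tableau_zero :
    ∑ c, tableau k D 0 c = (abscissas D.steps).sum + (n + 1).choose 2 := by
  rw [← D.sum_top_columns, ← D.sum_columns]
  exact Finset.sum_congr rfl fun c _ => D.tableau_zero c

lemma sum_tableau_last :
    ∑ c, tableau k D (Fin.last k) c = D.area + (k + 1) * (n + 1).choose 2 := by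
  rw [D.area_add_eq_sum_bot_columns, ← D.sum_columns]
  exact Finset.sum_congr rfl fun c _ => D.tableau_last c

lemma tableau_lt_tableau_last {c d : Fin n} (hcd : c < d) (r : Fin (k + 1)) :
    tableau k D r c < tableau k D (Fin.last k) d := by
  have hc : (c : ℕ) < D.columns.length := by rw [D.length_columns]; exact c.2
  have hd : (d : ℕ) < D.columns.length := by rw [D.length_columns]; exact d.2
  have h := List.pairwise_iff_getElem.1 D.filled_columns.interlaced c d hc hd hcd
  have h1 := D.tableau_mem r c
  rw [D.tableau_last, List.getElem?_eq_getElem hd, Option.getD_some]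
  rw [List.getElem?_eq_getElem hc, Option.getD_some] at h1
  exact (h.complete (D.length_of_mem_columns _ (List.getElem_mem _))).2 _ h1

/-- Its own column already has `k` smaller entries. The bound keeps the natural-number subtraction
in `red` from truncating. -/
lemma le_tableau_last (c : Fin n) : k + 1 ≤ tableau k D (Fin.last k) c := by
  have hmem := D.getElem?_columns_getD_mem c
  have hcol := D.filled_columns.isColumn _ hmem
  rw [D.tableau_last, ← D.filled_columns.countP_lt_flatten
    (List.mem_flatten.2 ⟨_, hmem, bot_mem hcol.ne_nil⟩), ← D.length_of_mem_columns _ hmem,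
    ← hcol.countP_lt_bot]
  exact Nat.add_le_add_right ((List.sublist_flatten_of_mem hmem).countP_le) 1

lemma red_tableau_last_add (D : RationalDyckPath (k * (n + 1) + 1) (n + 1)) (c : Fin n) :
    red (tableau k D) (Fin.last k) c + (k + 1) = tableau k D (Fin.last k) c.succ := by
  have h : (Finset.univ.filter fun s : Fin (k + 1) =>
      tableau k D s 0 < tableau k D (Fin.last k) c.succ) = Finset.univ :=
    Finset.filter_true_of_mem fun s _ => D.tableau_lt_tableau_last (Fin.succ_pos c) s
  rw [red, Matrix.of_apply, h, Finset.card_univ, Fintype.card_fin]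
  exact Nat.sub_add_cancel (D.le_tableau_last _)

end RationalDyckPath

end FussDyck

open FussDyck
theorem mainTheorem6 (k : ℕ) :
    (∀ (n : ℕ) (D : RationalDyckPath (k * n + 1) n),
      coarea k D = (D.cellsAbove.card : ℤ) ∧
      coarea k D = (∑ i : Fin n, (tableau k D 0 i : ℤ)) - ((n + 1).choose 2 : ℤ) ∧
      (D.area : ℤ) = (∑ i : Fin n, (tableau k D (Fin.last k) i : ℤ))
        - ((k : ℤ) + 1) * ((n + 1).choose 2 : ℤ)) ∧
    (∀ (n : ℕ) (D : RationalDyckPath (k * (n + 1) + 1) (n + 1))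
      (D' : RationalDyckPath (k * n + 1) n) (j : ℤ),
      red (tableau k D) = tableau k D' →
      (tableau k D (Fin.last k) 0 : ℤ) = (k : ℤ) + j →
      (D.area : ℤ) = (D'.area : ℤ) + j - 1) := by
  refine ⟨fun n D => ?_, fun n D D' j hred hj => ?_⟩
  · have h1 := D.area_add_sum_abscissas
    have h2 := D.sum_tableau_zero
    have h3 := D.sum_tableau_last
    rw [coarea, D.card_cellsAbove]
    generalize (abscissas D.steps).sum = a at h1 h2 ⊢
    zify at h1 h2 h3
    rw [h2, h3]
    refine ⟨?_, ?_, ?_⟩ <;> linarith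
  · have h1 := D.sum_tableau_last
    have h2 := D'.sum_tableau_last
    -- The first bottom entry is split off, and each of the others is a bottom entry of `tableau k
    -- D'` plus `k + 1`.
    rw [Fin.sum_univ_succ, ← Finset.sum_congr rfl fun c _ => D.red_tableau_last_add c,
      Finset.sum_add_distrib, hred, h2, Nat.choose_succ_succ' (n + 1) 1,
      Nat.choose_one_right] at h1
    simp only [Finset.sum_const, Finset.card_univ, Fintype.card_fin, smul_eq_mul] at h1
    zify at h1
    rw [hj] at h1
    linarith
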